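/- Let $R$ be an associative ring with unity; modules are left $R$-modules. A submodule $A$ of $B$ is an $RD$-submodule if $A\cap rB=rA$ for all $r\in R$, and a pure submodule if every finite system of linear equations with parameters in $A$ that has a solution in $B$ has a solution in $A$. Let $\mathcal M$ be one of: all embeddings, $RD$-embeddings, pure embeddings, that is, the injective homomorphisms whose image is, respectively, a submodule, an $RD$-submodule, a pure submodule. An $\mathcal M$-epimorphism is a surjective homomorphism $g$ such that the inclusion of $\ker g$ is an $\mathcal M$-embedding. Let $K$ be a class of $R$-modules that is closed under direct sums, under $\mathcal M$-submodules (if $A\in K$ and the inclusion of a submodule $B$ in $A$ is an $\mathcal M$-embedding, then $B\in K$), and under $\mathcal M$-epimorphic images (if $A\in K$ and $A\to B$ is an $\mathcal M$-epimorphism, then $B\in K$). A module $E$ (in $K$ or not) is $\mathcal K_{\mathcal M}$-injective if for every $\mathcal M$-embedding $f:A\to B$ with $A,B\in K$ and every homomorphism $g:A\to E$ there is a homomorphism $h:B\to E$ with $h\circ f=g$. It is $\Sigma$-$\mathcal K_{\mathcal M}$-injective if the direct sum $E^{(I)}$ of $I$ copies of $E$ is $\mathcal K_{\mathcal M}$-injective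 for every set $I$. A module $C$ is cotorsion if $\operatorname{Ext}^1_R(F,C)=0$ for every flat module $F$; a module $C$ is $\Sigma$-cotorsion if $C^{(I)}$ is cotorsion for every set $I$. Then: 1. A module $E$ is $\Sigma$-$\mathcal K_{\mathcal M}$-injective if and only if $E^{(\operatorname{card}(R)+\aleph_0)}$ is $\mathcal K_{\mathcal M}$-injective. 2. A flat module $F$ is $\Sigma$-cotorsion if and only if $F^{(\operatorname{card}(R)+\aleph_0)}$ is cotorsion. -/

import Mathlib

open scoped TensorProduct DirectSum

universe w u v

/-- A (possibly proper) class of left `R`-modules, as a predicate on the modules of a universe. -/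
abbrev ModuleClass (R : Type u) [Ring R] : Type (max u (w + 1)) :=
  ∀ (A : Type w) [AddCommGroup A] [Module R A], Prop

/-- `A` is an `RD`-submodule of `B`: `A ∩ rB = rA` for every `r ∈ R`. -/
def IsRDSubmodule {R B : Type*} [Ring R] [AddCommGroup B] [Module R B]
    (A : Submodule R B) : Prop :=
  ∀ r : R, (A : Set B) ∩ {x | ∃ b : B, x = r • b} = {x | ∃ a ∈ A, x = r • a}

/-- `A` is a pure submodule of `B`: every finite system of linear equations
`∑ j, r i j • x j = a i` with parameters `a i ∈ A` that has a solution in `B`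
has a solution in `A`. -/
def IsPureSubmodule {R B : Type*} [Ring R] [AddCommGroup B] [Module R B]
    (A : Submodule R B) : Prop :=
  ∀ (m n : ℕ) (r : Fin m → Fin n → R) (a : Fin m → B), (∀ i, a i ∈ A) →
    (∃ x : Fin n → B, ∀ i, ∑ j, r i j • x j = a i) →
    ∃ y : Fin n → B, (∀ j, y j ∈ A) ∧ ∀ i, ∑ j, r i j • y j = a i

/-- The three kinds of embeddings: all embeddings, `RD`-embeddings, pure embeddings. -/
inductive EmbeddingKind
  | emb
  | rd
  | pure

namespace EmbeddingKind

/-- The relation `A ≤_𝓜 B` for a submodule `A` of `B`. -/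
def IsSub {R B : Type*} [Ring R] [AddCommGroup B] [Module R B] :
    EmbeddingKind → Submodule R B → Prop
  | emb, _ => True
  | rd, A => IsRDSubmodule A
  | pure, A => IsPureSubmodule A

/-- `f` is an `𝓜`-embedding: it is injective and its image is an `𝓜`-submodule. -/
def IsEmbedding {R A B : Type*} [Ring R] [AddCommGroup A] [Module R A] [AddCommGroup B]
    [Module R B] (𝓜 : EmbeddingKind) (f : A →ₗ[R] B) : Prop :=
  Function.Injective f ∧ 𝓜.IsSub (LinearMap.range f)

/-- `g` is an `𝓜`-epimorphism: the last map of a short exact sequence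
`0 → ker g → B → C → 0` whose first map is an `𝓜`-embedding. -/
def IsEpimorphism {R B C : Type*} [Ring R] [AddCommGroup B] [Module R B] [AddCommGroup C]
    [Module R C] (𝓜 : EmbeddingKind) (g : B →ₗ[R] C) : Prop :=
  Function.Surjective g ∧ 𝓜.IsSub (LinearMap.ker g)

end EmbeddingKind

/-- `K` is closed under direct sums, `𝓜`-submodules and `𝓜`-epimorphic images. (Taking
isomorphisms as epimorphisms, this includes closure under isomorphism.) -/
structure IsAdmissibleClass {R : Type u} [Ring R] (K : ModuleClass.{w} R)
    (𝓜 : EmbeddingKind) : Prop where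
  directSum : ∀ (ι : Type w) (A : ι → Type w) [∀ i, AddCommGroup (A i)] [∀ i, Module R (A i)],
    (∀ i, K (A i)) → K (⨁ i, A i)
  submodule : ∀ (A : Type w) [AddCommGroup A] [Module R A] (B : Submodule R A),
    K A → 𝓜.IsSub B → K B
  epimorphicImage : ∀ (A B : Type w) [AddCommGroup A] [Module R A] [AddCommGroup B] [Module R B]
    (f : A →ₗ[R] B), 𝓜.IsEpimorphism f → K A → K B

/-- `E` is `𝒦_𝓜`-injective: homomorphisms into `E` extend along `𝓜`-embeddings between members
of `K`. The module `E` itself may or may not belong to `K`. -/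
def IsRelInjective {R : Type u} [Ring R] (K : ModuleClass.{w} R) (𝓜 : EmbeddingKind)
    (E : Type w) [AddCommGroup E] [Module R E] : Prop :=
  ∀ (A B : Type w) [AddCommGroup A] [Module R A] [AddCommGroup B] [Module R B],
    K A → K B → ∀ f : A →ₗ[R] B, 𝓜.IsEmbedding f → ∀ g : A →ₗ[R] E, ∃ h : B →ₗ[R] E, h ∘ₗ f = g

/-- `E` is `Σ`-`𝒦_𝓜`-injective: `E^{(I)}` is `𝒦_𝓜`-injective for every set `I`. -/
def IsSigmaRelInjective {R : Type u} [Ring R] (K : ModuleClass.{w} R) (𝓜 : EmbeddingKind)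
    (E : Type w) [AddCommGroup E] [Module R E] : Prop :=
  ∀ I : Type w, IsRelInjective K 𝓜 (I →₀ E)

section Flat

variable (R : Type*) [Ring R]

/-- The subgroup of `M ⊗_ℤ F` generated by the relations `(m r) ⊗ x = m ⊗ (r x)`, for a right
module `M` and a left module `F`. -/
def balancedRelations (M F : Type*) [AddCommGroup M] [Module Rᵐᵒᵖ M] [AddCommGroup F]
    [Module R F] : AddSubgroup (M ⊗[ℤ] F) :=
  AddSubgroup.closure {t | ∃ (m : M) (r : R) (x : F),
    t = (MulOpposite.op r • m) ⊗ₜ[ℤ] x - m ⊗ₜ[ℤ] (r • x)}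

/-- The abelian group `M ⊗_R F`, for a right module `M` and a left module `F` over a ring that
need not be commutative. -/
abbrev BalancedTensor (M F : Type*) [AddCommGroup M] [Module Rᵐᵒᵖ M] [AddCommGroup F]
    [Module R F] : Type _ :=
  (M ⊗[ℤ] F) ⧸ balancedRelations R M F

/-- The map `f ⊗ id : M ⊗_R F → N ⊗_R F` induced by a homomorphism `f : M → N` of right
modules. -/
def balancedMap {M N : Type*} (F : Type*) [AddCommGroup M] [Module Rᵐᵒᵖ M] [AddCommGroup N]
    [Module Rᵐᵒᵖ N] [AddCommGroup F] [Module R F] (f : M →ₗ[Rᵐᵒᵖ] N) :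
    BalancedTensor R M F →+ BalancedTensor R N F :=
  QuotientAddGroup.map _ _ (f.toAddMonoidHom.toIntLinearMap.rTensor F).toAddMonoidHom <| by
    refine (AddSubgroup.closure_le _).2 ?_
    rintro _ ⟨m, r, x, rfl⟩
    refine AddSubgroup.subset_closure ⟨f m, r, x, ?_⟩
    rw [map_sub]
    change f (MulOpposite.op r • m) ⊗ₜ[ℤ] x - f m ⊗ₜ[ℤ] (r • x) = _
    rw [map_smul]

/-- The left module `F` is flat: `- ⊗_R F` preserves injectivity of homomorphisms of right
modules. -/
def IsFlatModule (F : Type w) [AddCommGroup F] [Module R F] : Prop :=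
  ∀ (M N : Type w) [AddCommGroup M] [Module Rᵐᵒᵖ M] [AddCommGroup N] [Module Rᵐᵒᵖ N]
    (f : M →ₗ[Rᵐᵒᵖ] N), Function.Injective f → Function.Injective (balancedMap R F f)

/-- The left module `C` is cotorsion: `Ext¹_R(F, C) = 0` for every flat left module `F`. -/
def IsCotorsionModule [Small.{w} R] (C : Type w) [AddCommGroup C] [Module R C] : Prop :=
  ∀ (F : Type w) [AddCommGroup F] [Module R F], IsFlatModule R F →
    Subsingleton (CategoryTheory.Abelian.Ext (ModuleCat.of R F) (ModuleCat.of R C) 1)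

/-- The left module `F` is `Σ`-cotorsion: `F^{(I)}` is cotorsion for every set `I`. -/
def IsSigmaCotorsionModule [Small.{w} R] (F : Type w) [AddCommGroup F] [Module R F] : Prop :=
  ∀ I : Type w, IsCotorsionModule R (I →₀ F)

end Flat

/-! Put κ = #R + ℵ₀. Each kind of embedding says that a certain set of linear systems, solvable in
the ambient module, is solvable in the submodule. This condition passes to directed unions, so
Zorn's lemma reduces extending a map A → E^(I) to B to adding one element b to a domain C
(`exists_extension_of_step`). By Löwenheim–Skolem (`exists_small_solvesIn`), b lies in some B₀ with
at most κ elements such that B₀, C ∩ B₀ (inside B₀) and C + B₀ are again closed under solutions. It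
remains to extend from C ∩ B₀ to B₀. Since B₀ is small, the given map has its values in E^(J) with
#J ≤ κ, so injectivity of E^(κ) suffices (`exists_extension_of_small`).

For cotorsion modules, Ext¹(G, C) = 0 means that maps to C extend from the kernel of a projective
presentation of G. For a free presentation, G is flat iff this kernel is pure. The same argument
then runs inside the free module, with B₀ chosen free as well, so that B₀ / (C ∩ B₀) is flat and the
hypothesis on E^(κ) applies. -/

section LinearSystems

/-! ### Submodules closed under solving systems, and one-step extension -/

variable {R : Type u} [Ring R] {B : Type*} [AddCommGroup B] [Module R B]

/-- The left-hand sides of finite systems of linear equations over `R`: `m` equations in `n`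
unknowns. -/
abbrev LinSystem (R : Type u) : Type u := Σ m : ℕ, Σ n : ℕ, Fin m → Fin n → R

/-- The value of the left-hand side of a system. -/
def LinSystem.eval (s : LinSystem R) (x : Fin s.2.1 → B) (i : Fin s.1) : B :=
  ∑ j, s.2.2 i j • x j

theorem LinSystem.eval_add (s : LinSystem R) (x y : Fin s.2.1 → B) (i : Fin s.1) :
    s.eval (x + y) i = s.eval x i + s.eval y i := by
  simp [LinSystem.eval, Finset.sum_add_distrib]

theorem LinSystem.eval_sub (s : LinSystem R) (x y : Fin s.2.1 → B) (i : Fin s.1) :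
    s.eval (x - y) i = s.eval x i - s.eval y i := by
  simp [LinSystem.eval, smul_sub]

theorem LinSystem.eval_map {B' : Type*} [AddCommGroup B'] [Module R B'] (f : B →ₗ[R] B')
    (s : LinSystem R) (x : Fin s.2.1 → B) (i : Fin s.1) :
    s.eval (fun j => f (x j)) i = f (s.eval x i) := by
  simp [LinSystem.eval]

/-- Every system of `S` with parameters in `A` that is solvable in the ambient module is solvable
in `A`. -/
def SolvesIn (S : Set (LinSystem R)) (A : Submodule R B) : Prop :=
  ∀ s ∈ S, ∀ a : Fin s.1 → B, (∀ i, a i ∈ A) → (∃ x : Fin s.2.1 → B, ∀ i, s.eval x i = a i) →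
    ∃ y : Fin s.2.1 → B, (∀ j, y j ∈ A) ∧ ∀ i, s.eval y i = a i

/-- The systems that define the submodules of a given kind. -/
def EmbeddingKind.systems (R : Type u) : EmbeddingKind → Set (LinSystem R)
  | emb => ∅
  | rd => {s | ∃ r : R, s = ⟨1, 1, fun _ _ => r⟩}
  | pure => Set.univ

theorem EmbeddingKind.isSub_iff_solvesIn (𝓜 : EmbeddingKind) (A : Submodule R B) :
    𝓜.IsSub A ↔ SolvesIn (𝓜.systems R) A := by
  cases 𝓜 with
  | emb => simp [EmbeddingKind.IsSub, SolvesIn, EmbeddingKind.systems]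
  | rd =>
    constructor
    · rintro h _ ⟨r, rfl⟩ a ha ⟨x, hx⟩
      have h1 : a 0 ∈ {x | ∃ a ∈ A, x = r • a} := by
        rw [← h r]
        exact ⟨ha 0, x 0, by simpa [LinSystem.eval] using (hx 0).symm⟩
      obtain ⟨y, hy, hy'⟩ := h1
      refine ⟨fun _ => y, fun _ => hy, fun i => ?_⟩
      obtain rfl : i = 0 := Subsingleton.elim _ _
      simp [LinSystem.eval, hy']
    · intro h r
      ext z
      constructor
      · rintro ⟨hz, b, hb⟩
        obtain ⟨y, hy, hy'⟩ := h ⟨1, 1, fun _ _ => r⟩ ⟨r, rfl⟩ (fun _ => z) (fun _ => hz)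
          ⟨fun _ => b, fun i => by simp [LinSystem.eval, hb]⟩
        exact ⟨y 0, hy 0, by simpa [LinSystem.eval] using (hy' 0).symm⟩
      · rintro ⟨y, hy, rfl⟩
        exact ⟨A.smul_mem r hy, y, rfl⟩
  | pure =>
    constructor
    · rintro h ⟨m, n, r⟩ - a ha hx
      exact h m n r a ha hx
    · intro h m n r a ha hx
      exact h ⟨m, n, r⟩ trivial a ha hx

/-- A system has finitely many parameters, so by directedness they all lie in one member of `c`. -/
theorem solvesIn_sSup {S : Set (LinSystem R)} {c : Set (Submodule R B)} (hne : c.Nonempty)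
    (hc : DirectedOn (· ≤ ·) c) (h : ∀ A ∈ c, SolvesIn S A) : SolvesIn S (sSup c) := by
  intro s hs a ha hx
  have key : ∀ t : Finset (Fin s.1), ∃ A ∈ c, ∀ i ∈ t, a i ∈ A := by
    classical
    intro t
    induction t using Finset.induction_on with
    | empty => obtain ⟨A, hA⟩ := hne; exact ⟨A, hA, by simp⟩
    | insert i t _ ih =>
      obtain ⟨A, hA, hAt⟩ := ih
      obtain ⟨A', hA', hi⟩ := (Submodule.mem_sSup_of_directed hne hc).1 (ha i)
      obtain ⟨D, hD, h1, h2⟩ := hc A hA A' hA'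
      refine ⟨D, hD, fun k hk => ?_⟩
      rcases Finset.mem_insert.1 hk with rfl | hk
      · exact h2 hi
      · exact h1 (hAt k hk)
  obtain ⟨A, hA, hA'⟩ := key Finset.univ
  obtain ⟨y, hy, hy'⟩ := h A hA s hs a (fun i => hA' i (Finset.mem_univ i)) hx
  exact ⟨y, fun j => (le_sSup hA : A ≤ sSup c) (hy j), hy'⟩

/-- Homomorphisms defined on a submodule extend to the whole module if they can always be extended
to one more element without losing the solvability of the systems in `S` in the domain. -/
theorem exists_extension_of_step {S : Set (LinSystem R)} {E : Type*} [AddCommGroup E] [Module R E]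
    (step : ∀ C : Submodule R B, SolvesIn S C → ∀ b : B, ∃ B₀ : Submodule R B, b ∈ B₀ ∧
      SolvesIn S (C ⊔ B₀) ∧ ∀ g : C.comap B₀.subtype →ₗ[R] E, ∃ h : B₀ →ₗ[R] E,
        h ∘ₗ (C.comap B₀.subtype).subtype = g)
    (A : Submodule R B) (hA : SolvesIn S A) (g : A →ₗ[R] E) :
    ∃ h : B →ₗ[R] E, h ∘ₗ A.subtype = g := by
  let g₀ : B →ₗ.[R] E := ⟨A, g⟩
  obtain ⟨f, hf₀, hf⟩ := zorn_le_nonempty₀ {f : B →ₗ.[R] E | SolvesIn S f.domain} (by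
    intro c hcs hc f hf
    have hd := hc.directedOn
    refine ⟨LinearPMap.sSup c hd, ?_, fun z hz => LinearPMap.le_sSup hd hz⟩
    change SolvesIn S (LinearPMap.sSup c hd).domain
    rw [LinearPMap.domain_sSup]
    refine solvesIn_sSup ⟨_, f, hf, rfl⟩ ?_ ?_
    · rintro _ ⟨p, hp, rfl⟩ _ ⟨q, hq, rfl⟩
      obtain ⟨r, hr, h1, h2⟩ := hd p hp q hq
      exact ⟨_, ⟨r, hr, rfl⟩, h1.1, h2.1⟩
    · rintro _ ⟨p, hp, rfl⟩
      exact hcs hp) g₀ hA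
  have htop : f.domain = ⊤ := by
    refine eq_top_iff.2 fun b _ => ?_
    obtain ⟨B₀, hb, hsup, hext⟩ := step f.domain hf.prop b
    obtain ⟨h, hh⟩ := hext (f.toFun ∘ₗ
      LinearMap.codRestrict f.domain
        (B₀.subtype ∘ₗ (f.domain.comap B₀.subtype).subtype) (fun x => x.2))
    -- `h` and `f` agree on C ∩ B₀, so they glue on C + B₀; maximality of `f` then puts `b` in its
    -- domain.
    have hcompat : ∀ (x : f.domain) (y : (LinearPMap.mk B₀ h).domain), (x : B) = y →
        f x = (LinearPMap.mk B₀ h) y := by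
      rintro ⟨x, hx⟩ ⟨y, hy⟩ (rfl : x = y)
      exact (LinearMap.congr_fun hh ⟨⟨x, hy⟩, hx⟩).symm
    have hle := hf.le_of_ge (y := f.sup ⟨B₀, h⟩ hcompat) hsup (LinearPMap.left_le_sup _ _ _)
    exact hle.1 (Submodule.mem_sup_right hb)
  refine ⟨f.toFun ∘ₗ LinearMap.codRestrict f.domain LinearMap.id (fun x => htop ▸ trivial), ?_⟩
  ext x
  exact (hf₀.2 (x := x) (y := ⟨x, hf₀.1 x.2⟩) rfl).symm

end LinearSystems

/-! ### Löwenheim–Skolem closures -/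

section Closure

open Cardinal

theorem mk_linSystem_le (R : Type u) : #(LinSystem R) ≤ #R + ℵ₀ := by
  have h : ℵ₀ ≤ #R + ℵ₀ := by simp
  have hpow : ∀ n : ℕ, (#R + ℵ₀) ^ n ≤ #R + ℵ₀ := fun n => power_nat_le h
  have hle : #R ≤ #R + ℵ₀ := by simp
  have h1 : ∀ m n : ℕ, #(Fin m → Fin n → R) ≤ #R + ℵ₀ := by
    intro m n
    simp only [mk_pi, prod_const, mk_fin, lift_natCast, power_natCast, lift_uzero]
    exact (pow_le_pow_left' (pow_le_pow_left' hle n) m).trans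
      ((pow_le_pow_left' (by simpa using hpow n) m).trans (by simpa using hpow m))
  have h2 : ∀ {X : ℕ → Type u}, (∀ n, #(X n) ≤ #R + ℵ₀) → #(Σ n, X n) ≤ #R + ℵ₀ := by
    intro X hX
    rw [mk_sigma]
    refine (sum_le_lift_mk_mul_iSup _).trans ?_
    simp only [mk_nat, lift_aleph0]
    exact mul_le_of_le h h (ciSup_le' hX)
  exact h2 fun m => h2 fun n => h1 m n

variable {R : Type u} [Ring R] {B : Type*} [AddCommGroup B] [Module R B]

/-- Löwenheim–Skolem: a module with at most `#R + ℵ₀` finitary operations has a small submodule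
closed under these operations and containing a given element. -/
theorem exists_small_closed_submodule {ι : Type u} (hι : #ι ≤ #R + ℵ₀) (ar : ι → ℕ)
    (F : ∀ i, (Fin (ar i) → B) → B) (b : B) :
    ∃ B₀ : Submodule R B, b ∈ B₀ ∧ (∀ i a, (∀ j, a j ∈ B₀) → F i a ∈ B₀) ∧
      ∃ (W : Type u) (p : W → B₀), #W ≤ #R + ℵ₀ ∧ Function.Surjective p := by
  let Op : Type u := Option (Option (R ⊕ ι))
  let arity : Op → ℕ
    | none => 0
    | some none => 2
    | some (some (Sum.inl _)) => 1
    | some (some (Sum.inr i)) => ar i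
  let val : ∀ o : Op, (Fin (arity o) → B) → B
    | none => fun _ => b
    | some none => fun x => x (0 : Fin 2) + x (1 : Fin 2)
    | some (some (Sum.inl r)) => fun x => r • x (0 : Fin 1)
    | some (some (Sum.inr i)) => F i
  -- `W` is the set of closed terms in the constant `b`, addition, the scalars and the `F i`.
  -- Arities are finite, so it has at most #R + ℵ₀ elements. Its values form `B₀`; zero occurs as `0
  -- • b`.
  let W : Type u := WType (fun o : Op => ULift.{u} (Fin (arity o)))
  let ev : W → B := WType.elim B (fun x => val x.1 (fun j => x.2 ⟨j⟩))
  have hW : #W ≤ #R + ℵ₀ := by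
    refine WType.cardinalMk_le_max_aleph0_of_finite.trans (max_le ?_ (by simp))
    have h : ℵ₀ ≤ #R + ℵ₀ := by simp
    simp only [Op, mk_option, mk_sum, lift_id]
    refine add_le_of_le h (add_le_of_le h (add_le_of_le h (by simp) hι) ?_) ?_ <;>
      exact one_le_aleph0.trans h
  have hop : ∀ (o : Op) (a : Fin (arity o) → B), (∀ j, a j ∈ Set.range ev) →
      val o a ∈ Set.range ev := by
    intro o a ha
    choose t ht using ha
    refine ⟨WType.mk o fun j => t j.down, ?_⟩
    change val o (fun j => ev (t j)) = _
    simp only [ht]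
  have hb : b ∈ Set.range ev := hop none Fin.elim0 (fun j => j.elim0)
  have hsmul : ∀ (r : R) {x : B}, x ∈ Set.range ev → r • x ∈ Set.range ev := fun r x hx =>
    hop (some (some (Sum.inl r))) (fun _ => x) (fun _ => hx)
  let B₀ : Submodule R B :=
    { carrier := Set.range ev
      add_mem' := by
        intro x y hx hy
        refine hop (some none) ![x, y] (fun j => ?_)
        match j with
        | ⟨0, _⟩ => exact hx
        | ⟨1, _⟩ => exact hy
      zero_mem' := by simpa using hsmul 0 hb
      smul_mem' := fun r x hx => hsmul r hx }
  refine ⟨B₀, hb, fun i a ha => hop (some (some (Sum.inr i))) a ha, W,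
    fun t => ⟨ev t, t, rfl⟩, hW, ?_⟩
  rintro ⟨_, t, rfl⟩
  exact ⟨t, rfl⟩

/-- Small submodules `B₀` that are, together with their trace on `C` and their image modulo `C`,
closed under solutions of systems. -/
theorem exists_small_solvesIn (S : Set (LinSystem R)) {C : Submodule R B} (hC : SolvesIn S C)
    (F : ℕ → B → B) (b : B) :
    ∃ B₀ : Submodule R B, b ∈ B₀ ∧ (∀ k, ∀ x ∈ B₀, F k x ∈ B₀) ∧ SolvesIn S B₀ ∧
      SolvesIn S (C.comap B₀.subtype) ∧ SolvesIn S (C ⊔ B₀) ∧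
      ∃ (W : Type u) (p : W → B₀), #W ≤ #R + ℵ₀ ∧ Function.Surjective p := by
  classical
  let P : Submodule R B → Submodule R B → ∀ s : LinSystem R, (Fin s.1 → B) →
    (Fin s.2.1 → B) → Prop :=
    fun D D' s a x => (∀ j, x j ∈ D) ∧ ∀ i, s.eval x i - a i ∈ D'
  let sol : Submodule R B → Submodule R B → ∀ s : LinSystem R, (Fin s.1 → B) →
    (Fin s.2.1 → B) := fun D D' s a => if h : ∃ x, P D D' s a x then h.choose else 0
  -- `sol` is a Skolem function for solutions in `D` modulo `D'`. The pairs (C, 0), (B, 0), (B, C)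
  -- serve C ∩ B₀, B₀ and C + B₀ respectively.
  let D₁ : Fin 3 → Submodule R B := ![C, ⊤, ⊤]
  let D₂ : Fin 3 → Submodule R B := ![⊥, ⊥, C]
  let ι : Type u := (Fin 3 × Σ s : LinSystem R, Fin s.2.1) ⊕ ℕ
  have h₀ : ℵ₀ ≤ #R + ℵ₀ := by simp
  have hι : #ι ≤ #R + ℵ₀ := by
    simp only [ι, mk_sum, mk_prod, mk_sigma, lift_uzero, mk_fin, lift_natCast]
    refine add_le_of_le h₀ ?_ (by simp)
    refine mul_le_of_le h₀ ((natCast_le_aleph0 (n := 3)).trans h₀) ?_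
    refine (sum_le_lift_mk_mul_iSup_lift _).trans ?_
    refine mul_le_of_le h₀ (by simpa using mk_linSystem_le R) (ciSup_le' fun s => ?_)
    simpa using natCast_le_aleph0.trans h₀
  let ar : ι → ℕ
    | Sum.inl q => q.2.1.1
    | Sum.inr _ => 1
  let op : ∀ i : ι, (Fin (ar i) → B) → B
    | Sum.inl q => fun a => sol (D₁ q.1) (D₂ q.1) q.2.1 a q.2.2
    | Sum.inr k => fun a => F k (a (0 : Fin 1))
  obtain ⟨B₀, hb, hcl, hW⟩ := exists_small_closed_submodule hι ar op b
  have hsol : ∀ (t : Fin 3) (s : LinSystem R) (a : Fin s.1 → B), (∀ i, a i ∈ B₀) →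
      (∃ x, P (D₁ t) (D₂ t) s a x) →
      ∃ y, P (D₁ t) (D₂ t) s a y ∧ ∀ j, y j ∈ B₀ := by
    intro t s a ha hx
    refine ⟨sol (D₁ t) (D₂ t) s a, ?_, fun j => hcl (Sum.inl ⟨t, s, j⟩) a ha⟩
    simp only [sol, dif_pos hx]
    exact hx.choose_spec
  refine ⟨B₀, hb, fun k x hx => hcl (Sum.inr k) (fun _ => x) (fun _ => hx), ?_, ?_, ?_, hW⟩
  · rintro s - a ha ⟨x, hx⟩
    obtain ⟨y, ⟨-, hy⟩, hy'⟩ := hsol 1 s a ha ⟨x, fun _ => trivial, fun i => by simp [D₂, hx i]⟩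
    exact ⟨y, hy', fun i => sub_eq_zero.1 (by simpa [D₂] using hy i)⟩
  · rintro s hs a ha ⟨x, hx⟩
    obtain ⟨x', hx', hxa⟩ := hC s hs (fun i => a i) ha ⟨fun j => x j, fun i => by
      rw [← hx i]; exact s.eval_map B₀.subtype x i⟩
    obtain ⟨y, ⟨hyC, hy⟩, hy'⟩ := hsol 0 s (fun i => a i) (fun i => (a i).2)
      ⟨x', hx', fun i => by simp [D₂, hxa i]⟩
    refine ⟨fun j => ⟨y j, hy' j⟩, fun j => hyC j, fun i => Subtype.ext ?_⟩
    have h1 := sub_eq_zero.1 (show s.eval y i - a i = 0 by simpa [D₂] using hy i)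
    rw [← h1]
    exact (s.eval_map B₀.subtype (fun j => ⟨y j, hy' j⟩) i).symm
  · rintro s hs a ha ⟨x, hx⟩
    choose c hc d hd hcd using fun i => Submodule.mem_sup.1 (ha i)
    obtain ⟨y, ⟨-, hy⟩, hy'⟩ := hsol 2 s d hd
      ⟨x, fun _ => trivial, fun i => by simpa [D₂, hx i, ← hcd i] using hc i⟩
    -- Here a = c + d and y in B₀ solves the system for d modulo C. Hence s(x - y) = c - (s(y) - d)
    -- lies in C and equals s(z) with z in C; the solution sought is z + y.
    obtain ⟨z, hz, hz'⟩ := hC s hs (fun i => s.eval (x - y) i) (fun i => by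
      have h1 : s.eval y i - d i ∈ C := by simpa [D₂] using hy i
      have h2 := C.sub_mem (hc i) h1
      rw [LinSystem.eval_sub, hx i, ← hcd i]
      convert h2 using 1
      abel) ⟨x - y, fun _ => rfl⟩
    refine ⟨z + y, fun j => Submodule.add_mem_sup (hz j) (hy' j), fun i => ?_⟩
    rw [LinSystem.eval_add, hz' i, LinSystem.eval_sub, hx i]
    abel

end Closure

/-! ### Reduction of the index set, and relative injectivity -/

section SmallExtension

open Cardinal

/-- `E` need not be a retract of `E'`: it is enough that `r ∘ s` fixes the image of `g`. -/
theorem extension_of_retract {R A B E E' : Type*} [Ring R] [AddCommGroup A] [Module R A]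
    [AddCommGroup B] [Module R B] [AddCommGroup E] [Module R E] [AddCommGroup E'] [Module R E']
    {f : A →ₗ[R] B} (h : ∀ g : A →ₗ[R] E', ∃ h : B →ₗ[R] E', h ∘ₗ f = g)
    (s : E →ₗ[R] E') (r : E' →ₗ[R] E) {g : A →ₗ[R] E} (hg : r ∘ₗ s ∘ₗ g = g) :
    ∃ h : B →ₗ[R] E, h ∘ₗ f = g := by
  obtain ⟨k, hk⟩ := h (s ∘ₗ g)
  exact ⟨r ∘ₗ k, by rw [LinearMap.comp_assoc, hk, hg]⟩

/-- Homomorphisms from a small module to `E^(I)` extend if those to `E^(#R + ℵ₀)` do. -/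
theorem exists_extension_of_small {R : Type u} [Ring R] {A B : Type*} [AddCommGroup A] [Module R A]
    [AddCommGroup B] [Module R B] {E : Type*} {I : Type w} [AddCommGroup E] [Module R E]
    (f : A →ₗ[R] B) (hf : Function.Injective f) {W : Type u} (p : W → B) (hW : #W ≤ #R + ℵ₀)
    (hp : Function.Surjective p)
    (hA : ∀ g : A →ₗ[R] ((#R + ℵ₀).out →₀ E), ∃ h : B →ₗ[R] ((#R + ℵ₀).out →₀ E), h ∘ₗ f = g)
    (g : A →ₗ[R] (I →₀ E)) : ∃ h : B →ₗ[R] (I →₀ E), h ∘ₗ f = g := by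
  -- `T w` is finite because `p w` has at most one preimage under `f`; the union `J` contains the
  -- supports of all values of `g`.
  let T : W → Set I := fun w => {i | ∃ a, f a = p w ∧ g a i ≠ 0}
  have hT : ∀ w, (T w).Finite := fun w => by
    by_cases hw : ∃ a, f a = p w
    · obtain ⟨a, ha⟩ := hw
      refine (g a).support.finite_toSet.subset ?_
      rintro i ⟨b, hb, hi⟩
      obtain rfl : b = a := hf (hb.trans ha.symm)
      simpa using hi
    · convert Set.finite_empty
      ext i
      simp only [T, Set.mem_ofPred_eq, Set.mem_empty_iff_false, iff_false]
      rintro ⟨a, ha, -⟩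
      exact hw ⟨a, ha⟩
  let J : Set I := ⋃ w, T w
  have hJ : lift.{u} #J ≤ lift.{w} #(#R + ℵ₀).out := by
    have h₀ : ℵ₀ ≤ lift.{w} (#R + ℵ₀) := by simp
    rw [mk_out]
    refine (mk_iUnion_le_lift T).trans (mul_le_of_le h₀ (lift_le.2 hW) (ciSup_le' fun w => ?_))
    exact (lift_le_aleph0.2 (hT w).lt_aleph0.le).trans h₀
  obtain ⟨ι⟩ := lift_mk_le'.1 hJ
  -- The composite E^(I) → E^(J) → E^(κ) → E^(J) → E^(I) is the projection to the coordinates in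
  -- `J`.
  refine extension_of_retract hA
    (Finsupp.lmapDomain E R ι ∘ₗ Finsupp.lcomapDomain (Subtype.val : J → I) Subtype.val_injective)
    (Finsupp.lmapDomain E R (Subtype.val : J → I) ∘ₗ Finsupp.lcomapDomain ι ι.injective) ?_
  ext a : 1
  have h1 := Finsupp.leftInverse_lcomapDomain_mapDomain (R := R) (M := E) ι ι.injective
  simp only [LinearMap.comp_apply, Finsupp.lmapDomain_apply]
  rw [h1]
  refine Finsupp.mapDomain_comapDomain _ Subtype.val_injective _ ?_
  intro i hi
  obtain ⟨w, hw⟩ := hp (f a)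
  simp only [Subtype.range_coe_subtype, Set.ofPred_mem_eq]
  exact Set.mem_iUnion.2 ⟨w, a, hw.symm, by simpa using hi⟩

variable {R : Type u} [Ring R]

/-- B₀ is in K as an 𝓜-submodule of B, and C ∩ B₀ as one of B₀, so the hypothesis applies to C ∩ B₀
⊆ B₀. -/
theorem IsRelInjective.sigma {K : ModuleClass.{max u v} R} {𝓜 : EmbeddingKind}
    (hK : IsAdmissibleClass K 𝓜) {E : Type (max u v)} [AddCommGroup E] [Module R E]
    (hE : IsRelInjective K 𝓜 ((#R + ℵ₀).out →₀ E)) : IsSigmaRelInjective K 𝓜 E := by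
  intro I A B _ _ _ _ hA hB f ⟨hf, hf'⟩ g
  obtain ⟨h, hh⟩ := exists_extension_of_step (S := 𝓜.systems R) (E := I →₀ E) (fun C hC b => by
    obtain ⟨B₀, hb, -, hB₀, hCB₀, hsup, W, p, hW, hp⟩ :=
      exists_small_solvesIn (𝓜.systems R) hC (fun _ x => x) b
    refine ⟨B₀, hb, hsup, exists_extension_of_small _ (Submodule.injective_subtype _) p hW hp ?_⟩
    rw [← 𝓜.isSub_iff_solvesIn] at hB₀ hCB₀
    have hKB := hK.submodule B B₀ hB hB₀
    refine hE _ _ (hK.submodule B₀ _ hKB hCB₀) hKB _ ⟨Submodule.injective_subtype _, ?_⟩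
    rwa [Submodule.range_subtype]) (LinearMap.range f) ((𝓜.isSub_iff_solvesIn _).1 hf')
    (g ∘ₗ (LinearEquiv.ofInjective f hf).symm.toLinearMap)
  refine ⟨h, ?_⟩
  ext1 a
  have := LinearMap.congr_fun hh (LinearEquiv.ofInjective f hf a)
  simpa using this

theorem IsSigmaRelInjective.relInjective {K : ModuleClass.{max u v} R} {𝓜 : EmbeddingKind}
    {E : Type (max u v)} [AddCommGroup E] [Module R E] (hE : IsSigmaRelInjective K 𝓜 E)
    (I : Type u) : IsRelInjective K 𝓜 (I →₀ E) := by
  intro A B _ _ _ _ hA hB f hf g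
  exact extension_of_retract (hE (ULift.{max u v} I) A B hA hB f hf)
    (Finsupp.domLCongr (R := R) (M := E) Equiv.ulift.symm).toLinearMap
    (Finsupp.domLCongr (R := R) (M := E) Equiv.ulift).toLinearMap (by ext; simp)

end SmallExtension

/-! ### Tensor products via free presentations; pure kernels give flat quotients -/

section Flatness

variable {R : Type u} [Ring R] {X : Type*}

section Scale

variable (M : Type*) [AddCommGroup M] [Module Rᵐᵒᵖ M]

/-- The additive map sending `m` and `∑ₓ rₓ eₓ` to `∑ₓ (m rₓ) eₓ`. -/
noncomputable def freeScale : M →+ (X →₀ R) →+ (X →₀ M) :=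
  AddMonoidHom.mk' (fun m => Finsupp.mapRange.addMonoidHom
    (((smulAddHom Rᵐᵒᵖ M).flip m).comp MulOpposite.opAddEquiv.toAddMonoidHom))
    (fun m n => by ext; simp)

variable {M}

@[simp]
theorem freeScale_apply (m : M) (p : X →₀ R) (x : X) :
    freeScale M m p x = MulOpposite.op (p x) • m := by
  simp [freeScale]

theorem freeScale_single (m : M) (x : X) (r : R) :
    freeScale M m (Finsupp.single x r) = Finsupp.single x (MulOpposite.op r • m) := by
  simp [freeScale]

theorem freeScale_smul (m : M) (r : R) (p : X →₀ R) :
    freeScale M m (r • p) = freeScale M (MulOpposite.op r • m) p := by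
  ext x
  simp [mul_smul]

theorem mapRange_freeScale {N : Type*} [AddCommGroup N] [Module Rᵐᵒᵖ N] (f : M →ₗ[Rᵐᵒᵖ] N)
    (m : M) (p : X →₀ R) :
    Finsupp.mapRange.addMonoidHom f.toAddMonoidHom (freeScale M m p) = freeScale N (f m) p := by
  ext x
  simp

variable (M) in
/-- The image of `M ⊗ C` in `M ⊗ R^(X) = M^(X)`. -/
noncomputable def freeRelations (C : Submodule R (X →₀ R)) : AddSubgroup (X →₀ M) :=
  AddSubgroup.closure {t | ∃ (m : M) (c : X →₀ R), c ∈ C ∧ t = freeScale M m c}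

theorem freeScale_mem {C : Submodule R (X →₀ R)} (m : M) {c : X →₀ R} (hc : c ∈ C) :
    freeScale M m c ∈ freeRelations M C :=
  AddSubgroup.subset_closure ⟨m, c, hc, rfl⟩

theorem exists_sum_of_mem_freeRelations {C : Submodule R (X →₀ R)} {t : X →₀ M}
    (ht : t ∈ freeRelations M C) :
    ∃ (n : ℕ) (m : Fin n → M) (c : Fin n → X →₀ R), (∀ j, c j ∈ C) ∧
      t = ∑ j, freeScale M (m j) (c j) := by
  induction ht using AddSubgroup.closure_induction with
  | mem t ht =>
    obtain ⟨m, c, hc, rfl⟩ := ht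
    exact ⟨1, fun _ => m, fun _ => c, fun _ => hc, by simp⟩
  | zero => exact ⟨0, Fin.elim0, Fin.elim0, fun j => j.elim0, by simp⟩
  | add s t _ _ hs ht =>
    obtain ⟨n, m, c, hc, rfl⟩ := hs
    obtain ⟨n', m', c', hc', rfl⟩ := ht
    refine ⟨n + n', Fin.append m m', Fin.append c c', fun j => ?_, ?_⟩
    · refine Fin.addCases (fun i => ?_) (fun i => ?_) j
      · simpa using hc i
      · simpa using hc' i
    · simp [Fin.sum_univ_add]
  | neg t _ ht =>
    obtain ⟨n, m, c, hc, rfl⟩ := ht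
    exact ⟨n, fun j => -m j, c, hc, by simp⟩

end Scale

/-- The class of a pure tensor in the balanced tensor product. -/
def balancedMk (R : Type*) [Ring R] {M F : Type*} [AddCommGroup M] [Module Rᵐᵒᵖ M]
    [AddCommGroup F] [Module R F] : M →+ F →+ BalancedTensor R M F :=
  AddMonoidHom.mk' (fun m => (QuotientAddGroup.mk' _).comp
      (TensorProduct.mk ℤ M F m).toAddMonoidHom)
    (fun m n => by ext x; simp)

section BalancedMk

variable {M N G : Type*} [AddCommGroup M] [Module Rᵐᵒᵖ M] [AddCommGroup N] [Module Rᵐᵒᵖ N]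
  [AddCommGroup G] [Module R G]

theorem balancedMk_smul (m : M) (r : R) (x : G) :
    balancedMk R m (r • x) = balancedMk R (MulOpposite.op r • m) x := by
  symm
  rw [← sub_eq_zero]
  exact (QuotientAddGroup.eq_zero_iff _).2 (AddSubgroup.subset_closure ⟨m, r, x, rfl⟩)

theorem balancedMap_mk (f : M →ₗ[Rᵐᵒᵖ] N) (m : M) (x : G) :
    balancedMap R G f (balancedMk R m x) = balancedMk R (f m) x := rfl

theorem balancedTensor_induction {P : BalancedTensor R M G → Prop}
    (mk : ∀ m x, P (balancedMk R m x)) (zero : P 0)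
    (add : ∀ s t, P s → P t → P (s + t)) (t : BalancedTensor R M G) : P t := by
  obtain ⟨t, rfl⟩ := QuotientAddGroup.mk_surjective t
  induction t using TensorProduct.induction_on with
  | zero => exact zero
  | tmul m x => exact mk m x
  | add s t hs ht => exact add _ _ hs ht

/-- The homomorphism from `M ⊗ G` to a group `Q` given by a balanced biadditive map. -/
noncomputable def balancedLift {Q : Type*} [AddCommGroup Q] (b : M →+ G →+ Q)
    (hb : ∀ m (r : R) x, b (MulOpposite.op r • m) x = b m (r • x)) :
    BalancedTensor R M G →+ Q :=
  QuotientAddGroup.lift _ (TensorProduct.liftAddHom b (by intro z m x; simp)) <| by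
    refine (AddSubgroup.closure_le _).2 ?_
    rintro _ ⟨m, r, x, rfl⟩
    change _ = _
    rw [map_sub, sub_eq_zero]
    exact hb m r x

end BalancedMk

section Presentation

variable {G : Type*} [AddCommGroup G] [Module R G] (π : (X →₀ R) →ₗ[R] G)
  (M : Type*) [AddCommGroup M] [Module Rᵐᵒᵖ M]

/-- The homomorphism `M^(X) → M ⊗ G` induced by a homomorphism `R^(X) → G`. -/
noncomputable def ofFree : (X →₀ M) →+ BalancedTensor R M G :=
  Finsupp.liftAddHom fun x => (balancedMk R).flip (π (Finsupp.single x 1))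

variable {M}

theorem ofFree_single (x : X) (m : M) :
    ofFree π M (Finsupp.single x m) = balancedMk R m (π (Finsupp.single x 1)) := by
  simp [ofFree]

theorem ofFree_freeScale (m : M) (p : X →₀ R) :
    ofFree π M (freeScale M m p) = balancedMk R m (π p) := by
  induction p using Finsupp.induction_linear with
  | zero => simp
  | add p q hp hq => simp [hp, hq]
  | single x r =>
    rw [freeScale_single, ofFree_single, ← balancedMk_smul, ← map_smul, Finsupp.smul_single_one]

theorem ofFree_eq_zero {t : X →₀ M} (ht : t ∈ freeRelations M (LinearMap.ker π)) :
    ofFree π M t = 0 := by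
  obtain ⟨n, m, c, hc, rfl⟩ := exists_sum_of_mem_freeRelations ht
  simp only [map_sum, ofFree_freeScale]
  exact Finset.sum_eq_zero fun j _ => by rw [LinearMap.mem_ker.1 (hc j), map_zero]

theorem balancedMap_ofFree {N : Type*} [AddCommGroup N] [Module Rᵐᵒᵖ N] (f : M →ₗ[Rᵐᵒᵖ] N)
    (t : X →₀ M) : balancedMap R G f (ofFree π M t) =
      ofFree π N (Finsupp.mapRange.addMonoidHom f.toAddMonoidHom t) := by
  induction t using Finsupp.induction_linear with
  | zero => simp
  | add p q hp hq => rw [map_add, map_add, hp, hq, map_add, map_add]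
  | single x r => simp [ofFree_single, balancedMap_mk]

variable {π}

theorem ofFree_surjective (hπ : Function.Surjective π) : Function.Surjective (ofFree π M) := by
  intro t
  induction t using balancedTensor_induction with
  | mk m x =>
    obtain ⟨p, rfl⟩ := hπ x
    exact ⟨_, ofFree_freeScale π m p⟩
  | zero => exact ⟨0, map_zero _⟩
  | add s t hs ht =>
    obtain ⟨s, rfl⟩ := hs
    obtain ⟨t, rfl⟩ := ht
    exact ⟨s + t, map_add _ _ _⟩

/-- Right exactness of M ⊗ -. A set-theoretic section of π is additive and balanced modulo the
relations, which yields an inverse M ⊗ G → M^(X) / D. -/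
theorem ofFree_eq_zero_iff (hπ : Function.Surjective π) {t : X →₀ M} :
    ofFree π M t = 0 ↔ t ∈ freeRelations M (LinearMap.ker π) := by
  refine ⟨fun ht => ?_, ofFree_eq_zero π⟩
  let D := freeRelations M (LinearMap.ker π)
  let σ := Function.surjInv hπ
  have hσ : ∀ x, π (σ x) = x := Function.surjInv_eq hπ
  have key : ∀ (m : M) (p q : X →₀ R), π p = π q →
      (QuotientAddGroup.mk (freeScale M m p) : (X →₀ M) ⧸ D) =
        QuotientAddGroup.mk (freeScale M m q) := by
    intro m p q h
    rw [← sub_eq_zero, ← QuotientAddGroup.mk_sub, QuotientAddGroup.eq_zero_iff, ← map_sub]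
    exact freeScale_mem m (by simp [h])
  let b : M →+ G →+ (X →₀ M) ⧸ D := AddMonoidHom.mk' (fun m => AddMonoidHom.mk'
      (fun x => QuotientAddGroup.mk (freeScale M m (σ x))) (fun x y => by
        rw [← QuotientAddGroup.mk_add, ← map_add]
        exact key m _ _ (by simp [hσ])))
    (fun m n => by ext x; simp)
  let φ : BalancedTensor R M G →+ (X →₀ M) ⧸ D := balancedLift b (fun m r x => by
    change QuotientAddGroup.mk (freeScale M (MulOpposite.op r • m) (σ x)) = _
    rw [← freeScale_smul]
    exact key m _ _ (by simp [hσ]))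
  have hφ : ∀ t, φ (ofFree π M t) = QuotientAddGroup.mk t := by
    intro t
    induction t using Finsupp.induction_linear with
    | zero => simp
    | add p q hp hq => simp [hp, hq]
    | single x m =>
      rw [ofFree_single]
      refine (key m _ (Finsupp.single x 1) (hσ _)).trans ?_
      simp [freeScale_single]
  have := hφ t
  rw [ht, map_zero, eq_comm, QuotientAddGroup.eq_zero_iff] at this
  exact this

end Presentation

theorem IsPureSubmodule.exists_solution {B ι κ : Type*} [AddCommGroup B] [Module R B] [Fintype ι]
    [Fintype κ] {A : Submodule R B} (hA : IsPureSubmodule A) (r : ι → κ → R) (a : ι → B)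
    (ha : ∀ i, a i ∈ A) (x : κ → B) (hx : ∀ i, ∑ j, r i j • x j = a i) :
    ∃ y : κ → B, (∀ j, y j ∈ A) ∧ ∀ i, ∑ j, r i j • y j = a i := by
  let e := (Fintype.equivFin ι).symm
  let d := Fintype.equivFin κ
  obtain ⟨y, hy, hy'⟩ := hA _ _ (fun i j => r (e i) (d.symm j)) (fun i => a (e i))
    (fun i => ha _) ⟨fun j => x (d.symm j), fun i => by
      rw [← hx (e i)]
      exact Fintype.sum_equiv d.symm _ _ fun j => rfl⟩
  refine ⟨fun j => y (d j), fun j => hy _, fun i => ?_⟩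
  have h := hy' (e.symm i)
  rw [e.apply_symm_apply] at h
  rw [← h]
  exact Fintype.sum_equiv d _ _ fun j => by simp

variable {G : Type w} [AddCommGroup G] [Module R G] {π : (X →₀ R) →ₗ[R] G}

theorem isFlatModule_of_isPureSubmodule_ker (hπ : Function.Surjective π)
    (hker : IsPureSubmodule (LinearMap.ker π)) : IsFlatModule R G := by
  intro M N _ _ _ _ f hf
  rw [injective_iff_map_eq_zero]
  intro t ht
  obtain ⟨t, rfl⟩ := ofFree_surjective hπ t
  rw [balancedMap_ofFree, ofFree_eq_zero_iff hπ] at ht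
  refine ofFree_eq_zero π ?_
  obtain ⟨n, m, c, hc, hsum⟩ := exists_sum_of_mem_freeRelations ht
  classical
  let s : Finset X := Finset.univ.biUnion fun j => (c j).support
  have hexp : ∀ j, ∑ x : s, c j x • (Finsupp.single (x : X) (1 : R)) = c j := by
    intro j
    rw [Finset.sum_coe_sort s (fun x => c j x • Finsupp.single x (1 : R))]
    have h1 := (c j).sum_single
    rw [Finsupp.sum_of_support_subset _ (s := s)
      (Finset.subset_biUnion_of_mem (fun j => (c j).support) (Finset.mem_univ j)) _ (by simp)] at h1
    simpa using h1
  -- The basis vectors solve ∑ₓ cⱼ(x) eₓ = cⱼ, whose parameters lie in the kernel; purity replaces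
  -- them by yₓ in the kernel. Then t and ∑ₓ t(x) yₓ have the same image under the injective map
  -- induced by `f`.
  obtain ⟨y, hy, hy'⟩ := hker.exists_solution (fun j (x : s) => c j x) c hc
    (fun x => Finsupp.single (x : X) (1 : R)) hexp
  have hf' : Function.Injective (Finsupp.mapRange.addMonoidHom (ι := X) f.toAddMonoidHom) :=
    Finsupp.mapRange_injective _ (map_zero f) hf
  have htx : ∀ x : X, f (t x) = ∑ j, MulOpposite.op (c j x) • m j := by
    intro x
    have := DFunLike.congr_fun hsum x
    simpa [Finsupp.finsetSum_apply] using this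
  have : t = ∑ x : s, freeScale M (t x) (y x) := by
    apply hf'
    simp only [map_sum, mapRange_freeScale, htx, hsum, AddMonoidHom.finsetSum_apply]
    rw [Finset.sum_comm]
    refine Finset.sum_congr rfl fun j _ => ?_
    conv_lhs => rw [← hy' j]
    simp only [map_sum, freeScale_smul]
  rw [this]
  exact AddSubgroup.sum_mem _ fun x _ => freeScale_mem _ (hy x)

theorem isFlatModule_quotient_of_isPureSubmodule {P : Type w} [AddCommGroup P] [Module R P]
    (e : (X →₀ R) ≃ₗ[R] P) {A : Submodule R P} (hA : IsPureSubmodule A) :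
    IsFlatModule R (P ⧸ A) := by
  refine isFlatModule_of_isPureSubmodule_ker (π := A.mkQ ∘ₗ e.toLinearMap)
    (A.mkQ_surjective.comp e.surjective) ?_
  rw [LinearMap.ker_comp, A.ker_mkQ]
  rintro m n r a ha ⟨x, hx⟩
  obtain ⟨y, hy, hy'⟩ := hA m n r (fun i => e (a i)) ha
    ⟨fun j => e (x j), fun i => by rw [← hx i]; simp⟩
  exact ⟨fun j => e.symm (y j), fun j => by simpa using hy j,
    fun i => e.injective (by simpa using hy' i)⟩

end Flatness

/-! ### Flat modules have pure kernels -/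

section FlatKernel

variable {R : Type u} [Ring R] {X : Type*} {G : Type (max u v)} [AddCommGroup G] [Module R G]
  {π : (X →₀ R) →ₗ[R] G}

/-- Let ρⱼ be the columns of the matrix and M their span in the right module R^m. The element ∑ ρⱼ ⊗
π(pⱼ) vanishes in R^m ⊗ G, so by flatness in M ⊗ G. Thus ∑ ρⱼ pⱼ = ∑ ρⱼ qⱼ with qⱼ in the kernel,
and the rows of this identity are the required equations. -/
theorem isPureSubmodule_ker_of_isFlatModule (hπ : Function.Surjective π)
    (hG : IsFlatModule R G) : IsPureSubmodule (LinearMap.ker π) := by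
  rintro m n r c hc ⟨p, hp⟩
  let N : Type (max u v) := ULift.{v} (Fin m → R)
  let ρ : Fin n → N := fun j => ⟨fun i => r i j⟩
  let M : Submodule Rᵐᵒᵖ N := Submodule.span Rᵐᵒᵖ (Set.range ρ)
  let ρ' : Fin n → M := fun j => ⟨ρ j, Submodule.subset_span ⟨j, rfl⟩⟩
  have hdown : ∀ (l : ℕ) (f : Fin l → N) (i : Fin m),
      (∑ j, f j).down i = ∑ j, (f j).down i := fun l f i =>
    map_sum ((Pi.evalAddMonoidHom (fun _ => R) i).comp
      (AddEquiv.ulift (α := Fin m → R)).toAddMonoidHom) f Finset.univ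
  have hsmul : ∀ (a : R) (x : N) (i : Fin m),
      (MulOpposite.op a • x).down i = x.down i * a := fun _ _ _ => rfl
  have hN : ∑ j, balancedMk R (ρ j) (π (p j)) = 0 := by
    let ε : Fin m → N := fun i => ⟨Pi.single i 1⟩
    have hρ : ∀ j, ρ j = ∑ i, MulOpposite.op (r i j) • ε i := by
      intro j
      apply ULift.down_injective
      ext k
      rw [hdown]
      simp [ρ, ε, hsmul, Pi.single_apply]
    simp only [hρ, map_sum, AddMonoidHom.finsetSum_apply, ← balancedMk_smul]
    rw [Finset.sum_comm]
    refine Finset.sum_eq_zero fun i _ => ?_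
    simp only [← map_smul, ← map_sum]
    rw [hp i, LinearMap.mem_ker.1 (hc i), map_zero]
  have hM : ∑ j, balancedMk R (ρ' j) (π (p j)) = 0 := by
    refine (injective_iff_map_eq_zero _).1 (hG M N M.subtype M.injective_subtype) _ ?_
    rw [map_sum]
    exact hN
  simp only [← ofFree_freeScale, ← map_sum] at hM
  rw [ofFree_eq_zero_iff hπ] at hM
  have key : ∀ t ∈ freeRelations M (LinearMap.ker π), ∃ q : Fin n → X →₀ R,
      (∀ j, q j ∈ LinearMap.ker π) ∧ t = ∑ j, freeScale M (ρ' j) (q j) := by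
    intro t ht
    obtain ⟨k, μ, d, hd, rfl⟩ := exists_sum_of_mem_freeRelations ht
    have hμ : ∀ l, ∃ s : Fin n → R, μ l = ∑ j, MulOpposite.op (s j) • ρ' j := by
      intro l
      obtain ⟨s, hs⟩ := (Submodule.mem_span_range_iff_exists_fun Rᵐᵒᵖ).1 (μ l).2
      exact ⟨fun j => (s j).unop, Subtype.ext (by simpa [ρ'] using hs.symm)⟩
    choose s hs using hμ
    refine ⟨fun j => ∑ l, s l j • d l, fun j => Submodule.sum_mem _ fun l _ =>
      Submodule.smul_mem _ _ (hd l), ?_⟩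
    simp only [hs, map_sum, AddMonoidHom.finsetSum_apply, freeScale_smul]
    rw [Finset.sum_comm]
  obtain ⟨q, hq, hpq⟩ := key _ hM
  refine ⟨q, hq, fun i => ?_⟩
  rw [← hp i]
  ext x
  have h1 := DFunLike.congr_fun hpq x
  simp only [Finsupp.finsetSum_apply, freeScale_apply] at h1
  have h2 := congrArg (fun z : M => (z : N).down i) h1
  simp only [AddSubmonoidClass.coe_finsetSum, hdown] at h2
  simpa [ρ', ρ, hsmul] using h2.symm

end FlatKernel

/-! ### Cotorsion modules and extension from kernels -/

section Cotorsion

open CategoryTheory CategoryTheory.Abelian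

/-- As Ext¹(P, C) = 0, the connecting map Hom(ker π, C) → Ext¹(G, C) is onto, and its kernel
consists of the maps that extend to P. -/
theorem subsingleton_ext_one_iff {R : Type u} [Ring R] [Small.{w} R] {P G C : Type w}
    [AddCommGroup P] [Module R P] [Module.Projective R P] [AddCommGroup G] [Module R G]
    [AddCommGroup C] [Module R C] (π : P →ₗ[R] G) (hπ : Function.Surjective π) :
    Subsingleton (Ext (ModuleCat.of R G) (ModuleCat.of R C) 1) ↔
      ∀ g : LinearMap.ker π →ₗ[R] C, ∃ h : P →ₗ[R] C, h ∘ₗ (LinearMap.ker π).subtype = g := by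
  let S : ShortComplex (ModuleCat.{w} R) :=
    ShortComplex.mk (ModuleCat.ofHom (LinearMap.ker π).subtype) (ModuleCat.ofHom π) (by
      ext x; exact x.2)
  have hS : S.ShortExact :=
    { exact := (ShortComplex.ShortExact.moduleCat_exact_iff_function_exact S).2
        (fun x => ⟨fun hx => ⟨⟨x, hx⟩, rfl⟩, by rintro ⟨y, rfl⟩; exact y.2⟩)
      mono_f := (ModuleCat.mono_iff_injective _).2 (Submodule.injective_subtype _)
      epi_g := (ModuleCat.epi_iff_surjective _).2 hπ }
  have : Projective S.X₂ := (IsProjective.iff_projective P).1 inferInstance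
  constructor
  · intro hsub g
    obtain ⟨y, hy⟩ := Ext.contravariant_sequence_exact₁ hS (ModuleCat.of R C)
      (Ext.mk₀ (ModuleCat.ofHom g : S.X₁ ⟶ ModuleCat.of R C)) (add_zero 1) (hsub.elim _ _)
    obtain ⟨h, rfl⟩ := (Ext.mk₀_bijective _ _).2 y
    rw [Ext.mk₀_comp_mk₀] at hy
    refine ⟨h.hom, ?_⟩
    exact congrArg ModuleCat.Hom.hom ((Ext.mk₀_bijective _ _).1 hy)
  · intro H
    refine subsingleton_of_forall_eq 0 fun x => ?_
    obtain ⟨y, rfl⟩ := Ext.contravariant_sequence_exact₃ hS (ModuleCat.of R C) x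
      (Ext.eq_zero_of_projective _) (add_zero 1)
    obtain ⟨g, rfl⟩ := (Ext.mk₀_bijective _ _).2 y
    obtain ⟨h, hh⟩ := H g.hom
    have : g = S.f ≫ ModuleCat.ofHom h := by
      ext1; exact hh.symm
    rw [this, ← Ext.mk₀_comp_mk₀, hS.extClass_comp_assoc]

variable {R : Type u} [Ring R]

open Cardinal

theorem isCotorsionModule_iff {C : Type (max u v)} [AddCommGroup C] [Module R C] :
    IsCotorsionModule R C ↔ ∀ (F : Type (max u v)) [AddCommGroup F] [Module R F],
      IsFlatModule R F → ∀ (P : Type (max u v)) [AddCommGroup P] [Module R P]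
        [Module.Projective R P] (π : P →ₗ[R] F), Function.Surjective π →
        ∀ g : LinearMap.ker π →ₗ[R] C, ∃ h : P →ₗ[R] C,
          h ∘ₗ (LinearMap.ker π).subtype = g := by
  constructor
  · intro hC F _ _ hF P _ _ _ π hπ
    exact (subsingleton_ext_one_iff π hπ).1 (hC F hF)
  · intro hC F _ _ hF
    have hπ : Function.Surjective (Finsupp.linearCombination R (id : F → F)) :=
      Finsupp.linearCombination_id_surjective R F
    exact (subsingleton_ext_one_iff _ hπ).2 (hC F hF _ _ hπ)

theorem IsSigmaCotorsionModule.isCotorsionModule {E : Type (max u v)} [AddCommGroup E]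
    [Module R E] (hE : IsSigmaCotorsionModule R E) (I : Type u) :
    IsCotorsionModule R (I →₀ E) := by
  rw [isCotorsionModule_iff]
  intro F _ _ hF P _ _ _ π hπ g
  exact extension_of_retract (isCotorsionModule_iff.1 (hE (ULift.{max u v} I)) F hF P π hπ)
    (Finsupp.domLCongr (R := R) (M := E) Equiv.ulift.symm).toLinearMap
    (Finsupp.domLCongr (R := R) (M := E) Equiv.ulift).toLinearMap
    (LinearMap.ext fun x => by ext i; simp [Finsupp.domLCongr])

/-- A submodule of a free module that contains the basis elements occurring in its members is free
on the basis elements it contains. -/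
theorem nonempty_basis_of_support {X P : Type*} [AddCommGroup P] [Module R P]
    (β : Module.Basis X R P) {B₀ : Submodule R P}
    (hB₀ : ∀ p ∈ B₀, ∀ x ∈ (β.repr p).support, β x ∈ B₀) :
    Nonempty (Module.Basis {x : X // β x ∈ B₀} R B₀) := by
  refine ⟨Module.Basis.mk (v := fun x : {x : X // β x ∈ B₀} => (⟨β x, x.2⟩ : B₀)) ?_ ?_⟩
  · refine LinearIndependent.of_comp B₀.subtype ?_
    exact β.linearIndependent.comp _ Subtype.val_injective
  · rintro ⟨p, hp⟩ -
    have h : ∑ x : (β.repr p).support, β.repr p x • (⟨β x, hB₀ p hp x x.2⟩ : B₀) = ⟨p, hp⟩ := by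
      refine Subtype.ext ?_
      rw [AddSubmonoidClass.coe_finsetSum]
      refine Eq.trans ?_ (β.linearCombination_repr p)
      exact Finset.sum_coe_sort (β.repr p).support fun x => β.repr p x • β x
    rw [← h]
    exact Submodule.sum_mem _ fun x _ => Submodule.smul_mem _ _
      (Submodule.subset_span ⟨⟨x, hB₀ p hp x x.2⟩, rfl⟩)

/-- In a free module, pure submodules can be enlarged by small free modules `B₀` along which
homomorphisms to `E^(I)` extend. -/
theorem exists_step_of_isCotorsionModule {E I X P : Type (max u v)} [AddCommGroup E] [Module R E]
    [AddCommGroup P] [Module R P] (β : Module.Basis X R P)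
    (hE : IsCotorsionModule R ((#R + ℵ₀).out →₀ E)) (C : Submodule R P)
    (hC : SolvesIn (EmbeddingKind.pure.systems R) C) (b : P) :
    ∃ B₀ : Submodule R P, b ∈ B₀ ∧ SolvesIn (EmbeddingKind.pure.systems R) (C ⊔ B₀) ∧
      ∀ g : C.comap B₀.subtype →ₗ[R] (I →₀ E), ∃ h : B₀ →ₗ[R] (I →₀ E),
        h ∘ₗ (C.comap B₀.subtype).subtype = g := by
  obtain ⟨B₀, hb, hcl, -, hCB₀, hsup, W, p, hW, hp⟩ := exists_small_solvesIn _ hC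
      -- The `k`-th operation returns the `k`-th basis element in the support of `p`, or 0 if there
      -- is none. Closure under all of them makes `B₀` free.
      (fun k p => if h : k < (β.repr p).support.toList.length then
        β ((β.repr p).support.toList.get ⟨k, h⟩) else 0) b
  refine ⟨B₀, hb, hsup, ?_⟩
  have hpure : IsPureSubmodule (C.comap B₀.subtype) :=
    (EmbeddingKind.pure.isSub_iff_solvesIn _).2 hCB₀
  obtain ⟨γ⟩ := nonempty_basis_of_support β (B₀ := B₀) (fun p hp x hx => by
    obtain ⟨⟨k, hk⟩, rfl⟩ := List.get_of_mem (Finset.mem_toList.2 hx)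
    simpa only [dif_pos hk] using hcl k p hp)
  have : Module.Projective R B₀ := Module.Projective.of_basis γ
  have hflat := isFlatModule_quotient_of_isPureSubmodule γ.repr.symm hpure
  have hext := isCotorsionModule_iff.{u, v}.1 hE _ hflat B₀ (C.comap B₀.subtype).mkQ
    (Submodule.mkQ_surjective _)
  rw [Submodule.ker_mkQ] at hext
  exact exists_extension_of_small _ (Submodule.injective_subtype _) p hW hp hext

theorem IsCotorsionModule.sigma {E : Type (max u v)} [AddCommGroup E] [Module R E]
    (hE : IsCotorsionModule R ((#R + ℵ₀).out →₀ E)) : IsSigmaCotorsionModule R E := by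
  intro I G _ _ hG
  have hπ : Function.Surjective (Finsupp.linearCombination R (id : G → G)) :=
    Finsupp.linearCombination_id_surjective R G
  rw [subsingleton_ext_one_iff _ hπ]
  exact exists_extension_of_step (exists_step_of_isCotorsionModule.{u, v} Finsupp.basisSingleOne hE) _
    ((EmbeddingKind.pure.isSub_iff_solvesIn _).1
      (isPureSubmodule_ker_of_isFlatModule.{u, v} hπ hG))

end Cotorsion

theorem mainTheorem10 (R : Type u) [Ring R] :
    (∀ (K : ModuleClass.{max u v} R) (𝓜 : EmbeddingKind), IsAdmissibleClass K 𝓜 →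
      ∀ (E : Type (max u v)) [AddCommGroup E] [Module R E],
        IsSigmaRelInjective K 𝓜 E ↔
          IsRelInjective K 𝓜 ((Cardinal.mk R + Cardinal.aleph0.{u}).out →₀ E)) ∧
    (∀ (F : Type (max u v)) [AddCommGroup F] [Module R F], IsFlatModule R F →
      (IsSigmaCotorsionModule R F ↔
        IsCotorsionModule R ((Cardinal.mk R + Cardinal.aleph0.{u}).out →₀ F))) :=
  ⟨fun _ _ hK _ _ _ => ⟨fun h => h.relInjective.{u, v} _, fun h => h.sigma.{u, v} hK⟩,
    fun _ _ _ _ => ⟨fun h => h.isCotorsionModule.{u, v} _, fun h => h.sigma.{u, v}⟩⟩
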